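/- Let $H$ be a finite simple graph on a vertex set $V$, let $S\subseteq V$, and let $\Delta\in\mathbb R$, $D>0$ and $\gamma\in[0,1)$. Assume that $H$ is a near-forest, i.e. every connected component $C$ of $H$ has tree-excess $|E(C)|-|V(C)|+1\le 1$, and that $H$ is $(\Delta,D)$-pseudorandom with respect to $S$, i.e. for every $u\in V$, $$|\{v\in V:\mathrm{dist}_H(u,v)\le r\}|\le D^{r-1}\Delta\ \text{ for all integers } r\ge 1,\qquad |\{v\in S:\mathrm{dist}_H(u,v)\le r\}|\le D^{r}\ \text{ for all integers } r\ge 0,$$ where vertices in different components are at distance $\infty$. Let $J\in\mathbb R^{V\times V}$ be a symmetric matrix supported on $E(H)$ (that is, $J_{ij}=0$ unless $ij\in E(H)$) with all entries in $[-\gamma/\sqrt D,\gamma/\sqrt D]$, let $h\in\mathbb R^V$ be arbitrary, and let $\mu_{J,h}$ be the Ising model, the probability distribution on $\{\pm1\}^V$ with $\mu_{J,h}(\sigma)\propto\exp\left(\tfrac12\sigma^\top J\sigma+\langle h,\sigma\rangle\right)$. Write $\mathrm{Cov}(\mu_{J,h})$ for its covariance matrix, $M_S$ for the matrix $M$ with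 all rows and columns outside $S$ set to zero, and $\|\cdot\|$ for the operator norm with respect to the Euclidean norm. Then $$\left\|\mathrm{Cov}(\mu_{J,h})_S\right\|\le\frac{e^{2\gamma/\sqrt D}}{(1-\gamma)^2}.$$ If moreover $\Delta\ge D$, then $$\left\|\mathrm{Cov}(\mu_{J,h})\right\|\le\frac{e^{2\gamma/\sqrt D}}{(1-\gamma)^2}\cdot\frac{\Delta}{D}.$$ -/

import Mathlib

noncomputable section

/-- The tree-excess `|E| - |V| + 1` of a finite (connected) graph. -/
def treeExcess {V : Type*} (G : SimpleGraph V) : ℤ :=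
  (G.edgeSet.ncard : ℤ) - (Nat.card V : ℤ) + 1

/-- A near-forest: every connected component has tree-excess at most `1`. -/
def IsNearForest {V : Type*} (H : SimpleGraph V) : Prop :=
  ∀ c : H.ConnectedComponent, treeExcess c.toSimpleGraph ≤ 1

/-- `(Δ, D)`-pseudorandomness with respect to `S`. The distance is the extended one, so vertices in
different components are at distance `∞` and lie in no common ball. -/
structure IsPseudorandom {V : Type*} (H : SimpleGraph V) (Δ D : ℝ) (S : Finset V) : Prop where
  ball_le : ∀ r : ℕ, 1 ≤ r → ∀ u : V,
    ({v : V | H.edist u v ≤ (r : ℕ∞)}.ncard : ℝ) ≤ D ^ (r - 1) * Δ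
  ball_inter_le : ∀ (r : ℕ) (u : V),
    ({v : V | v ∈ S ∧ H.edist u v ≤ (r : ℕ∞)}.ncard : ℝ) ≤ D ^ r

section Ising

variable {V : Type*} [Fintype V] [DecidableEq V]

/-- The value `± 1` of the spin configuration `σ ∈ {± 1}^V` at `i`, as a real number. -/
def spin (σ : V → ℤˣ) (i : V) : ℝ := ((σ i : ℤ) : ℝ)

/-- The weight `exp (½ σᵀ J σ + ⟨h, σ⟩)`. -/
def isingWeight (J : Matrix V V ℝ) (h : V → ℝ) (σ : V → ℤˣ) : ℝ :=
  Real.exp ((1 / 2 : ℝ) * ∑ i, ∑ j, spin σ i * J i j * spin σ j + ∑ i, h i * spin σ i)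

/-- The partition function. -/
def isingZ (J : Matrix V V ℝ) (h : V → ℝ) : ℝ :=
  ∑ σ : V → ℤˣ, isingWeight J h σ

/-- The probability of `σ` under the Ising model `μ_{J,h}`. -/
def isingProb (J : Matrix V V ℝ) (h : V → ℝ) (σ : V → ℤˣ) : ℝ :=
  isingWeight J h σ / isingZ J h

/-- Expectation under `μ_{J,h}`. -/
def isingExp (J : Matrix V V ℝ) (h : V → ℝ) (f : (V → ℤˣ) → ℝ) : ℝ :=
  ∑ σ : V → ℤˣ, isingProb J h σ * f σ

/-- The covariance matrix of `μ_{J,h}`. -/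
def isingCov (J : Matrix V V ℝ) (h : V → ℝ) : Matrix V V ℝ :=
  Matrix.of fun i j =>
    isingExp J h (fun σ => spin σ i * spin σ j)
      - isingExp J h (fun σ => spin σ i) * isingExp J h (fun σ => spin σ j)

/-- The matrix `M_S`: all rows and columns outside `S` are set to zero. -/
def restrictTo (M : Matrix V V ℝ) (S : Finset V) : Matrix V V ℝ :=
  Matrix.of fun i j => if i ∈ S ∧ j ∈ S then M i j else 0

/-- The operator norm of a matrix with respect to the Euclidean norm. -/
def opNorm (M : Matrix V V ℝ) : ℝ :=
  ‖Matrix.toEuclideanCLM (n := V) (𝕜 := ℝ) M‖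

end Ising

end

/-! Put `β = γ / √D`. The quadratic form of the covariance at `x` is the variance of `∑ x i σ i`,
and different components are uncorrelated, so one component suffices. Deleting its one possible
non-tree edge changes each probability by a factor at most `exp (2β)`, hence also each variance
(`sum_mul_isingCov_le_exp_mul`).

On the remaining rooted tree, the edge above `i` is the only interaction leaving its subtree. Given
the spins outside, the mean of `σ i` is affine in the parent's spin with slope at most `β`. Walking
up from the deeper vertex gives `|Cov i j| ≤ β ^ (a + b)`, where `a` and `b` count steps to a common
ancestor (`exists_abs_isingCov_le_pow`).

Such entries are dominated by a Gram matrix indexed by ancestors. At most `D ^ a * K` vertices lie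
`a` steps below a given one, and the factor `√D ^ (-a)` in `β ^ a` absorbs this growth.
Cauchy–Schwarz leaves two geometric series in `γ`, giving `K / (1 - γ) ^ 2`
(`quadratic_le_of_ancestor_decay`). The two claims are `K = 1` on `S` and `K = Δ / D` on all of `V`.
-/

/-! ### Influence of one spin across a single interaction -/

theorem abs_exp_sub_exp_neg_le (t : ℝ) :
    |Real.exp t - Real.exp (-t)| ≤ |t| * (Real.exp t + Real.exp (-t)) := by
  wlog ht : 0 ≤ t generalizing t
  · have := this (-t) (by linarith)
    rwa [neg_neg, abs_sub_comm, abs_neg, add_comm (Real.exp (-t))] at this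
  have h1 : (1 : ℝ) ≤ Real.exp (2 * t) := Real.one_le_exp (by linarith)
  -- At `x = exp (2t) - 1`, the bound `2x / (x + 2) ≤ log (1 + x)` says `tanh t ≤ t`.
  have h2 := Real.le_log_one_add_of_nonneg (x := Real.exp (2 * t) - 1) (by linarith)
  rw [add_sub_cancel, Real.log_exp, div_le_iff₀ (by linarith)] at h2
  have h3 : Real.exp (2 * t) * Real.exp (-t) = Real.exp t := by
    rw [← Real.exp_add]; congr 1; ring
  have h4 : 0 < Real.exp (-t) := Real.exp_pos _
  have h5 : Real.exp (-t) ≤ Real.exp t := Real.exp_le_exp.2 (by linarith)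
  rw [abs_of_nonneg (by linarith), abs_of_nonneg ht, ← h3]
  nlinarith [mul_le_mul_of_nonneg_right h2 h4.le]

/-- The conditional mean of a `±1` variable with prior weights `P`, `Q` given a neighbouring spin
`b` is an affine function of `b`, whose slope is at most the interaction strength. -/
theorem exists_affine_conditional_mean {P Q : ℝ} (hP : 0 ≤ P) (hQ : 0 ≤ Q) (hPQ : 0 < P + Q)
    (t : ℝ) :
    ∃ α I : ℝ, |I| ≤ |t| ∧ ∀ b : ℝ, b = 1 ∨ b = -1 →
      P * Real.exp (t * b) - Q * Real.exp (-(t * b)) =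
        (α + I * b) * (P * Real.exp (t * b) + Q * Real.exp (-(t * b))) := by
  have hu : 0 < Real.exp t := Real.exp_pos _
  have hv : 0 < Real.exp (-t) := Real.exp_pos _
  have huv : Real.exp t * Real.exp (-t) = 1 := by rw [← Real.exp_add]; simp
  have hle := abs_exp_sub_exp_neg_le t
  set u := Real.exp t
  set v := Real.exp (-t)
  have key : ∀ {x y : ℝ}, 0 < x → 0 < y → 0 < P * x + Q * y := by
    intro x y hx hy
    rcases hP.lt_or_eq with h | h
    · positivity
    · have : 0 < Q := by linarith
      positivity
  have h1 := key hu hv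
  have h2 := key hv hu
  -- Interpolation: half the sum and half the difference of the conditional means at `b = 1` and `b
  -- = -1`.
  refine ⟨((P * u - Q * v) / (P * u + Q * v) + (P * v - Q * u) / (P * v + Q * u)) / 2,
    ((P * u - Q * v) / (P * u + Q * v) - (P * v - Q * u) / (P * v + Q * u)) / 2, ?_, ?_⟩
  · have e : ((P * u - Q * v) / (P * u + Q * v) - (P * v - Q * u) / (P * v + Q * u)) / 2
        = (P * Q * (u + v) * (u - v)) / ((P * u + Q * v) * (P * v + Q * u)) := by
      rw [div_sub_div _ _ h1.ne' h2.ne', div_div, div_eq_div_iff (by positivity) (by positivity)]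
      ring
    have h12 := mul_pos h1 h2
    rw [e, abs_div, abs_of_pos h12, div_le_iff₀ h12, abs_mul,
      abs_of_nonneg (by positivity : 0 ≤ P * Q * (u + v))]
    -- The slope is extremal at `P = Q`, where it equals `tanh t`.
    have h3 : P * Q * (u + v) ^ 2 ≤ (P * u + Q * v) * (P * v + Q * u) := by
      have : (P * u + Q * v) * (P * v + Q * u) - P * Q * (u + v) ^ 2 = (P - Q) ^ 2 * (u * v) := by
        ring
      rw [huv] at this
      nlinarith [sq_nonneg (P - Q)]
    calc P * Q * (u + v) * |u - v| ≤ P * Q * (u + v) * (|t| * (u + v)) := by gcongr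
      _ = |t| * (P * Q * (u + v) ^ 2) := by ring
      _ ≤ _ := by gcongr
  · rintro b (rfl | rfl)
    · simp only [mul_one]
      change P * u - Q * v = _ * (P * u + Q * v)
      field_simp
      ring
    · simp only [mul_neg, mul_one, neg_neg]
      change P * v - Q * u = _ * (P * v + Q * u)
      field_simp
      ring

theorem sum_mul_comp_of_sign {X : Type*} [Fintype X] (F a : X → ℝ)
    (ha : ∀ x, a x = 1 ∨ a x = -1) (φ : ℝ → ℝ) :
    ∑ x, F x * φ (a x) =
      (∑ x, F x * ((1 + a x) / 2)) * φ 1 + (∑ x, F x * ((1 - a x) / 2)) * φ (-1) := by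
  rw [Finset.sum_mul, Finset.sum_mul, ← Finset.sum_add_distrib]
  refine Finset.sum_congr rfl fun x _ => ?_
  rcases ha x with h | h <;> rw [h] <;> ring

/-- For fixed `y`, the sum over `x` sees `F` only through its masses on `a = 1` and `a = -1`, while
`G` and `g` factor out. Hence one pair `α`, `I` serves every `g`. -/
theorem exists_affine_sum_prod {X Y : Type*} [Fintype X] [Nonempty X] [Fintype Y]
    (F a : X → ℝ) (G b : Y → ℝ) (hF : ∀ x, 0 < F x) (ha : ∀ x, a x = 1 ∨ a x = -1)
    (hb : ∀ y, b y = 1 ∨ b y = -1) (t : ℝ) :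
    ∃ α I : ℝ, |I| ≤ |t| ∧ ∀ g : Y → ℝ,
      ∑ p : X × Y, F p.1 * G p.2 * Real.exp (t * (a p.1 * b p.2)) * (a p.1 * g p.2) =
        ∑ p : X × Y, F p.1 * G p.2 * Real.exp (t * (a p.1 * b p.2)) *
          ((α + I * b p.2) * g p.2) := by
  have hP : 0 ≤ ∑ x, F x * ((1 + a x) / 2) := Finset.sum_nonneg fun x _ =>
    mul_nonneg (hF x).le (by rcases ha x with h | h <;> rw [h] <;> norm_num)
  have hQ : 0 ≤ ∑ x, F x * ((1 - a x) / 2) := Finset.sum_nonneg fun x _ =>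
    mul_nonneg (hF x).le (by rcases ha x with h | h <;> rw [h] <;> norm_num)
  have hPQ : 0 < ∑ x, F x * ((1 + a x) / 2) + ∑ x, F x * ((1 - a x) / 2) := by
    rw [← Finset.sum_add_distrib]
    refine Finset.sum_pos (fun x _ => ?_) Finset.univ_nonempty
    have := hF x
    linarith
  obtain ⟨α, I, hI, hαI⟩ := exists_affine_conditional_mean hP hQ hPQ t
  refine ⟨α, I, hI, fun g => ?_⟩
  rw [Fintype.sum_prod_type_right, Fintype.sum_prod_type_right]
  refine Finset.sum_congr rfl fun y _ => ?_
  have e1 := sum_mul_comp_of_sign F a ha fun s => Real.exp (t * (s * b y)) * s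
  have e2 := sum_mul_comp_of_sign F a ha fun s => Real.exp (t * (s * b y))
  have e3 := hαI (b y) (hb y)
  simp only [one_mul, mul_one, neg_mul, mul_neg] at e1 e2
  calc ∑ x, F x * G y * Real.exp (t * (a x * b y)) * (a x * g y)
      = (∑ x, F x * (Real.exp (t * (a x * b y)) * a x)) * (G y * g y) := by
        rw [Finset.sum_mul]; exact Finset.sum_congr rfl fun x _ => by ring
    _ = (∑ x, F x * Real.exp (t * (a x * b y))) * ((α + I * b y) * (G y * g y)) := by
        rw [e1, e2]; linear_combination (G y * g y) * e3
    _ = _ := by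
        rw [Finset.sum_mul]; exact Finset.sum_congr rfl fun x _ => by ring

theorem spin_eq_or {V : Type*} (σ : V → ℤˣ) (i : V) : spin σ i = 1 ∨ spin σ i = -1 := by
  rcases Int.units_eq_one_or (σ i) with h | h <;> simp [spin, h]

theorem isingWeight_pos {V : Type*} [Fintype V] (J : Matrix V V ℝ) (h : V → ℝ) (σ : V → ℤˣ) : 0 < isingWeight J h σ :=
  Real.exp_pos _

/-- If the interaction crosses the cut `(p, ¬ p)` only along the pair `(i, i')`, then the weight
factors over the two sides up to that single interaction. -/
theorem isingWeight_eq_of_cut {V : Type*} [Fintype V] {J : Matrix V V ℝ} (hJ : J.IsSymm) (h : V → ℝ) (p : V → Prop)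
    [DecidablePred p] {i i' : V} (hi : p i) (hi' : ¬ p i')
    (hcut : ∀ k l, p k → ¬ p l → J k l ≠ 0 → k = i ∧ l = i') (σ : V → ℤˣ) :
    isingWeight J h σ =
      Real.exp ((1 / 2 : ℝ) * ∑ k : {k // p k}, ∑ l : {l // p l}, spin σ k * J k l * spin σ l
        + ∑ k : {k // p k}, h k * spin σ k) *
      Real.exp ((1 / 2 : ℝ) * ∑ k : {k // ¬ p k}, ∑ l : {l // ¬ p l}, spin σ k * J k l * spin σ l
        + ∑ k : {k // ¬ p k}, h k * spin σ k) *
      Real.exp (J i i' * (spin σ i * spin σ i')) := by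
  rw [isingWeight, ← Real.exp_add, ← Real.exp_add]
  congr 1
  have hsplit : ∀ f : V → ℝ, ∑ k, f k = ∑ k : {k // p k}, f k + ∑ k : {k // ¬ p k}, f k :=
    fun f => (Fintype.sum_subtype_add_sum_subtype p f).symm
  have hPN : ∑ k : {k // p k}, ∑ l : {l // ¬ p l}, spin σ k * J k l * spin σ l
      = J i i' * (spin σ i * spin σ i') := by
    rw [Finset.sum_eq_single ⟨i, hi⟩, Finset.sum_eq_single ⟨i', hi'⟩]
    · ring
    · rintro ⟨l, hl⟩ - hne
      have : J i l = 0 := by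
        by_contra h0
        exact hne (Subtype.ext (hcut i l hi hl h0).2)
      simp [this]
    · simp
    · rintro ⟨k, hk⟩ - hne
      refine Finset.sum_eq_zero fun l _ => ?_
      have : J k l = 0 := by
        by_contra h0
        exact hne (Subtype.ext (hcut k l hk l.2 h0).1)
      simp [this]
    · simp
  have hNP : ∑ k : {k // ¬ p k}, ∑ l : {l // p l}, spin σ k * J k l * spin σ l
      = J i i' * (spin σ i * spin σ i') := by
    rw [← hPN, Finset.sum_comm]
    refine Finset.sum_congr rfl fun k _ => Finset.sum_congr rfl fun l _ => ?_
    rw [hJ.apply]; ring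
  rw [hsplit fun k => ∑ l, spin σ k * J k l * spin σ l, hsplit fun k => h k * spin σ k]
  simp only [hsplit fun l => spin σ _ * J _ l * spin σ l, Finset.sum_add_distrib, hPN, hNP]
  ring

theorem isingWeight_le_exp_mul {V : Type*} [Fintype V] {J J' : Matrix V V ℝ} (h : V → ℝ) {β : ℝ}
    (hJ : ∑ i, ∑ j, |J i j - J' i j| ≤ 2 * β) (σ : V → ℤˣ) :
    isingWeight J h σ ≤ Real.exp β * isingWeight J' h σ := by
  rw [isingWeight, isingWeight, ← Real.exp_add, Real.exp_le_exp]
  have : ∑ i, ∑ j, spin σ i * J i j * spin σ j -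
      ∑ i, ∑ j, spin σ i * J' i j * spin σ j ≤ 2 * β := by
    rw [← Finset.sum_sub_distrib]
    refine le_trans (Finset.sum_le_sum fun i _ => ?_) hJ
    rw [← Finset.sum_sub_distrib]
    refine Finset.sum_le_sum fun j _ => ?_
    have h1 := le_abs_self (J i j - J' i j)
    have h2 := neg_abs_le (J i j - J' i j)
    rcases spin_eq_or σ i with hi | hi <;> rcases spin_eq_or σ j with hj | hj <;> rw [hi, hj] <;>
      linarith
  linarith

/-! ### Expectations, covariances and their perturbation -/

section Ising

variable {V : Type*} [Fintype V] [DecidableEq V]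

theorem isingZ_pos (J : Matrix V V ℝ) (h : V → ℝ) : 0 < isingZ J h :=
  Finset.sum_pos (fun σ _ => isingWeight_pos J h σ) Finset.univ_nonempty

theorem isingProb_nonneg (J : Matrix V V ℝ) (h : V → ℝ) (σ : V → ℤˣ) : 0 ≤ isingProb J h σ :=
  (div_pos (isingWeight_pos J h σ) (isingZ_pos J h)).le

theorem sum_isingProb (J : Matrix V V ℝ) (h : V → ℝ) : ∑ σ, isingProb J h σ = 1 := by
  simp only [isingProb, ← Finset.sum_div]
  exact div_self (isingZ_pos J h).ne'

theorem isingExp_eq_div (J : Matrix V V ℝ) (h : V → ℝ) (f : (V → ℤˣ) → ℝ) :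
    isingExp J h f = (∑ σ, isingWeight J h σ * f σ) / isingZ J h := by
  rw [isingExp, Finset.sum_div]
  exact Finset.sum_congr rfl fun σ _ => by rw [isingProb]; ring

theorem isingExp_const (J : Matrix V V ℝ) (h : V → ℝ) (c : ℝ) :
    isingExp J h (fun _ => c) = c := by
  rw [isingExp, ← Finset.sum_mul, sum_isingProb, one_mul]

theorem isingExp_add (J : Matrix V V ℝ) (h : V → ℝ) (f g : (V → ℤˣ) → ℝ) :
    isingExp J h (fun σ => f σ + g σ) = isingExp J h f + isingExp J h g := by
  simp only [isingExp, mul_add, Finset.sum_add_distrib]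

theorem isingExp_const_mul (J : Matrix V V ℝ) (h : V → ℝ) (c : ℝ) (f : (V → ℤˣ) → ℝ) :
    isingExp J h (fun σ => c * f σ) = c * isingExp J h f := by
  rw [isingExp, isingExp, Finset.mul_sum]
  exact Finset.sum_congr rfl fun σ _ => by ring

theorem isingExp_sum {ι : Type*} (s : Finset ι) (J : Matrix V V ℝ) (h : V → ℝ)
    (f : ι → (V → ℤˣ) → ℝ) :
    isingExp J h (fun σ => ∑ i ∈ s, f i σ) = ∑ i ∈ s, isingExp J h (f i) := by
  simp only [isingExp, Finset.mul_sum]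
  exact Finset.sum_comm

theorem isingExp_mono (J : Matrix V V ℝ) (h : V → ℝ) {f g : (V → ℤˣ) → ℝ}
    (hfg : ∀ σ, f σ ≤ g σ) : isingExp J h f ≤ isingExp J h g :=
  Finset.sum_le_sum fun σ _ => mul_le_mul_of_nonneg_left (hfg σ) (isingProb_nonneg J h σ)

theorem exists_affine_isingExp_of_cut {J : Matrix V V ℝ} (hJ : J.IsSymm) (h : V → ℝ)
    (p : V → Prop) {i i' : V} (hi : p i) (hi' : ¬ p i')
    (hcut : ∀ k l, p k → ¬ p l → J k l ≠ 0 → k = i ∧ l = i') :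
    ∃ α I : ℝ, |I| ≤ |J i i'| ∧ ∀ g : ({k // ¬ p k} → ℤˣ) → ℝ,
      isingExp J h (fun σ => spin σ i * g fun k => σ k) =
        isingExp J h (fun σ => (α + I * spin σ i') * g fun k => σ k) := by
  classical
  obtain ⟨α, I, hI, H⟩ := exists_affine_sum_prod
    (fun ρ : {k // p k} → ℤˣ =>
      Real.exp ((1 / 2 : ℝ) * ∑ k : {k // p k}, ∑ l : {k // p k},
        spin ρ k * J k l * spin ρ l + ∑ k : {k // p k}, h k * spin ρ k))
    (fun ρ => spin ρ ⟨i, hi⟩)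
    (fun τ : {k // ¬ p k} → ℤˣ =>
      Real.exp ((1 / 2 : ℝ) * ∑ k : {k // ¬ p k}, ∑ l : {k // ¬ p k},
        spin τ k * J k l * spin τ l + ∑ k : {k // ¬ p k}, h k * spin τ k))
    (fun τ => spin τ ⟨i', hi'⟩) (fun _ => Real.exp_pos _) (fun ρ => spin_eq_or ρ _)
    (fun τ => spin_eq_or τ _) (J i i')
  refine ⟨α, I, hI, fun g => ?_⟩
  rw [isingExp_eq_div, isingExp_eq_div]
  congr 1
  simp only [isingWeight_eq_of_cut hJ h p hi hi' hcut]
  have e := H g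
  rw [← (Equiv.piEquivPiSubtypeProd p fun _ => ℤˣ).sum_comp,
    ← (Equiv.piEquivPiSubtypeProd p fun _ => ℤˣ).sum_comp] at e
  exact e

/-- If `i` is separated from the complement of `p` by the single interaction `J i i'`, then its
covariances with the other side are a fixed multiple of those of `i'`. -/
theorem exists_isingCov_eq_mul_of_cut {J : Matrix V V ℝ} (hJ : J.IsSymm) (h : V → ℝ)
    (p : V → Prop) {i i' : V} (hi : p i) (hi' : ¬ p i')
    (hcut : ∀ k l, p k → ¬ p l → J k l ≠ 0 → k = i ∧ l = i') :
    ∃ I : ℝ, |I| ≤ |J i i'| ∧ ∀ j, ¬ p j → isingCov J h i j = I * isingCov J h i' j := by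
  obtain ⟨α, I, hI, H⟩ := exists_affine_isingExp_of_cut hJ h p hi hi' hcut
  refine ⟨I, hI, fun j hj => ?_⟩
  -- The test functions `σ j` and `1` give the two terms of the covariance; `α` cancels between
  -- them.
  have e1 := H fun τ => spin τ ⟨j, hj⟩
  have e2 := H fun _ => 1
  simp only [mul_one] at e2
  change isingExp J h (fun σ => spin σ i * spin σ j) =
    isingExp J h (fun σ => (α + I * spin σ i') * spin σ j) at e1
  simp only [add_mul, mul_assoc, isingExp_add, isingExp_const_mul, isingExp_const] at e1 e2
  simp only [isingCov, Matrix.of_apply, e1, e2]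
  ring

theorem isingCov_comm (J : Matrix V V ℝ) (h : V → ℝ) (i j : V) :
    isingCov J h i j = isingCov J h j i := by
  simp only [isingCov, Matrix.of_apply, mul_comm]

theorem abs_isingCov_step {J : Matrix V V ℝ} (hJ : J.IsSymm) (h : V → ℝ)
    (p : V → Prop) {i i' j : V} (hi : p i) (hi' : ¬ p i') (hj : ¬ p j)
    (hcut : ∀ k l, p k → ¬ p l → J k l ≠ 0 → k = i ∧ l = i') :
    |isingCov J h i j| ≤ |J i i'| * |isingCov J h i' j| := by
  obtain ⟨I, hI, H⟩ := exists_isingCov_eq_mul_of_cut hJ h p hi hi' hcut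
  rw [H j hj, abs_mul]
  gcongr

/-- The one-interaction cut bound applies with `i' = j`, whose coupling to `i` vanishes. -/
theorem isingCov_eq_zero_of_separated {J : Matrix V V ℝ} (hJ : J.IsSymm) (h : V → ℝ)
    (p : V → Prop) {i j : V} (hi : p i) (hj : ¬ p j)
    (hcut : ∀ k l, p k → ¬ p l → J k l = 0) : isingCov J h i j = 0 := by
  have := abs_isingCov_step hJ h p hi hj hj fun k l hk hl h0 => absurd (hcut k l hk hl) h0
  rw [hcut i j hi hj, abs_zero, zero_mul] at this
  exact abs_nonpos_iff.1 this

theorem abs_isingCov_self_le (J : Matrix V V ℝ) (h : V → ℝ) (i : V) :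
    |isingCov J h i i| ≤ 1 := by
  have h1 : ∀ σ : V → ℤˣ, spin σ i * spin σ i = 1 := fun σ => by
    rcases spin_eq_or σ i with h | h <;> rw [h] <;> norm_num
  have h2 : isingExp J h (fun σ => spin σ i) ≤ 1 := by
    refine (isingExp_mono J h fun σ => ?_).trans (isingExp_const J h 1).le
    rcases spin_eq_or σ i with h | h <;> rw [h]; norm_num
  have h3 : -1 ≤ isingExp J h (fun σ => spin σ i) := by
    refine (isingExp_const J h (-1)).ge.trans (isingExp_mono J h fun σ => ?_)
    rcases spin_eq_or σ i with h | h <;> rw [h]; norm_num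
  simp only [isingCov, Matrix.of_apply, h1, isingExp_const]
  rw [abs_le]
  constructor <;> nlinarith

/-- The centre `c` is left free so that variances under two different measures can be compared about
a common point. -/
theorem sum_mul_isingCov_eq (J : Matrix V V ℝ) (h : V → ℝ) (x : V → ℝ) (c : ℝ) :
    ∑ i, ∑ j, x i * x j * isingCov J h i j =
      isingExp J h (fun σ => (∑ i, x i * spin σ i - c) ^ 2)
        - (isingExp J h (fun σ => ∑ i, x i * spin σ i) - c) ^ 2 := by
  have e1 : isingExp J h (fun σ => (∑ i, x i * spin σ i - c) ^ 2) =
      isingExp J h (fun σ => (∑ i, x i * spin σ i) * ∑ i, x i * spin σ i)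
        + (-(2 * c) * isingExp J h (fun σ => ∑ i, x i * spin σ i) + c ^ 2) := by
    rw [← isingExp_const_mul, ← isingExp_const J h (c ^ 2), ← isingExp_add, ← isingExp_add]
    congr 1; ext σ; ring
  have e2 : isingExp J h (fun σ => (∑ i, x i * spin σ i) * ∑ i, x i * spin σ i) =
      ∑ i, ∑ j, x i * x j * isingExp J h (fun σ => spin σ i * spin σ j) := by
    simp only [Finset.sum_mul_sum, isingExp_sum, ← isingExp_const_mul]
    refine Finset.sum_congr rfl fun i _ => Finset.sum_congr rfl fun j _ => ?_
    congr 1; ext σ; ring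
  have e3 : isingExp J h (fun σ => ∑ i, x i * spin σ i) =
      ∑ i, x i * isingExp J h (fun σ => spin σ i) := by
    simp only [isingExp_sum, isingExp_const_mul]
  have e4 : isingExp J h (fun σ => ∑ i, x i * spin σ i) *
      isingExp J h (fun σ => ∑ i, x i * spin σ i) =
      ∑ i, ∑ j, x i * x j * (isingExp J h (fun σ => spin σ i) *
        isingExp J h (fun σ => spin σ j)) := by
    rw [e3, Finset.sum_mul_sum]
    exact Finset.sum_congr rfl fun i _ => Finset.sum_congr rfl fun j _ => by ring
  simp only [isingCov, Matrix.of_apply, mul_sub, Finset.sum_sub_distrib]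
  rw [← e2, ← e4, e1]
  ring

theorem sum_mul_isingCov_nonneg (J : Matrix V V ℝ) (h : V → ℝ) (x : V → ℝ) :
    0 ≤ ∑ i, ∑ j, x i * x j * isingCov J h i j := by
  rw [sum_mul_isingCov_eq J h x (isingExp J h fun σ => ∑ i, x i * spin σ i), sub_self,
    zero_pow two_ne_zero, sub_zero, ← isingExp_const J h 0]
  exact isingExp_mono J h fun σ => sq_nonneg _

/-- One factor `exp β` comes from the weight and one from the partition function. -/
theorem isingProb_le_exp_mul {J J' : Matrix V V ℝ} (h : V → ℝ) {β : ℝ}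
    (hJ : ∑ i, ∑ j, |J i j - J' i j| ≤ 2 * β) (σ : V → ℤˣ) :
    isingProb J h σ ≤ Real.exp (2 * β) * isingProb J' h σ := by
  have hJ' : ∑ i, ∑ j, |J' i j - J i j| ≤ 2 * β := by simpa only [abs_sub_comm] using hJ
  have hZ : isingZ J' h ≤ Real.exp β * isingZ J h := by
    rw [isingZ, isingZ, Finset.mul_sum]
    exact Finset.sum_le_sum fun τ _ => isingWeight_le_exp_mul h hJ' τ
  have h0 := isingZ_pos J h
  have h0' := isingZ_pos J' h
  rw [isingProb, isingProb, ← mul_div_assoc, div_le_div_iff₀ h0 h0', two_mul, Real.exp_add]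
  calc isingWeight J h σ * isingZ J' h
      ≤ (Real.exp β * isingWeight J' h σ) * (Real.exp β * isingZ J h) :=
        mul_le_mul (isingWeight_le_exp_mul h hJ σ) hZ h0'.le
          (mul_nonneg (Real.exp_pos _).le (isingWeight_pos J' h σ).le)
    _ = _ := by ring

/-- Changing the interaction matrix by a small amount changes all variances of linear statistics
by at most a constant factor. -/
theorem sum_mul_isingCov_le_exp_mul {J J' : Matrix V V ℝ} (h : V → ℝ) {β : ℝ}
    (hJ : ∑ i, ∑ j, |J i j - J' i j| ≤ 2 * β) (x : V → ℝ) :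
    ∑ i, ∑ j, x i * x j * isingCov J h i j ≤
      Real.exp (2 * β) * ∑ i, ∑ j, x i * x j * isingCov J' h i j := by
  -- Centred at the `J'`-mean, the second moment is the variance under `J'` and at least the
  -- variance under `J`.
  set c := isingExp J' h fun σ => ∑ i, x i * spin σ i with hc
  rw [sum_mul_isingCov_eq J h x c, sum_mul_isingCov_eq J' h x c, ← hc, sub_self,
    zero_pow two_ne_zero, sub_zero]
  refine (sub_le_self _ (sq_nonneg _)).trans ?_
  rw [isingExp, isingExp, Finset.mul_sum]
  refine Finset.sum_le_sum fun σ _ => ?_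
  rw [← mul_assoc]
  exact mul_le_mul_of_nonneg_right (isingProb_le_exp_mul h hJ σ) (sq_nonneg _)

end Ising

/-! ### Operator norm from the quadratic form -/

theorem opNorm_le_of_abs_quadratic_le {V : Type*} [Fintype V] [DecidableEq V] {M : Matrix V V ℝ}
    (hM : M.IsSymm) {B : ℝ} (h : ∀ x : V → ℝ, |∑ i, ∑ j, x i * x j * M i j| ≤ B * ∑ i, x i ^ 2)
    (hB : 0 ≤ B) : opNorm M ≤ B := by
  have hq : ∀ x y : EuclideanSpace ℝ V,
      inner ℝ (Matrix.toEuclideanCLM (n := V) (𝕜 := ℝ) M x) y = ∑ i, ∑ j, y i * x j * M i j := by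
    intro x y
    rw [real_inner_comm, Matrix.inner_toEuclideanCLM]
    simp only [dotProduct, Matrix.mulVec, Finset.mul_sum]
    exact Finset.sum_congr rfl fun i _ => Finset.sum_congr rfl fun j _ => by ring
  have hsymm : (Matrix.toEuclideanCLM (n := V) (𝕜 := ℝ) M :
      EuclideanSpace ℝ V →ₗ[ℝ] EuclideanSpace ℝ V).IsSymmetric := by
    intro x y
    simp only [ContinuousLinearMap.coe_coe]
    rw [hq, real_inner_comm, hq, Finset.sum_comm]
    refine Finset.sum_congr rfl fun i _ => Finset.sum_congr rfl fun j _ => ?_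
    rw [hM.apply]; ring
  rw [opNorm, ContinuousLinearMap.norm_eq_iSup_rayleighQuotient _ hsymm]
  refine ciSup_le fun x => ?_
  rw [ContinuousLinearMap.rayleighQuotient, ContinuousLinearMap.reApplyInnerSelf_apply, hq,
    EuclideanSpace.real_norm_sq_eq, abs_div, RCLike.re_to_real,
    abs_of_nonneg (Finset.sum_nonneg fun i _ => sq_nonneg _ : 0 ≤ ∑ i, x i ^ 2)]
  exact div_le_of_le_mul₀ (Finset.sum_nonneg fun i _ => sq_nonneg _) hB (h x)

/-! ### Parent functions on near-forests -/

namespace SimpleGraph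

/-- A connected graph with at most as many edges as vertices has a breadth-first search tree,
encoded by its parent function, that contains all but at most one of the edges. -/
theorem Connected.exists_parent {W : Type*} [Finite W] {G : SimpleGraph W} (hG : G.Connected)
    (hE : G.edgeSet.ncard ≤ Nat.card W) :
    ∃ (ρ : W) (par : W → W) (depth : W → ℕ) (e : Sym2 W), par ρ = ρ ∧ depth ρ = 0 ∧
      (∀ v, v ≠ ρ → G.Adj v (par v) ∧ depth (par v) < depth v) ∧
      ∀ v w, G.Adj v w → s(v, w) = e ∨ w = par v ∨ v = par w := by
  classical
  obtain ⟨ρ⟩ := hG.nonempty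
  have hex : ∀ v, v ≠ ρ → ∃ w, G.Adj v w ∧ G.dist w ρ < G.dist v ρ := by
    intro v hv
    obtain ⟨p, hp⟩ := hG.exists_walk_length_eq_dist v ρ
    cases p with
    | nil => exact absurd rfl hv
    | cons hadj q =>
      refine ⟨_, hadj, ?_⟩
      rw [← hp, Walk.length_cons]
      exact Nat.lt_succ_of_le (dist_le q)
  choose! f hf using hex
  let par : W → W := fun v => if v = ρ then ρ else f v
  have hpar : ∀ v, v ≠ ρ → G.Adj v (par v) ∧ G.dist (par v) ρ < G.dist v ρ := by
    intro v hv
    simp only [par, if_neg hv]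
    exact hf v hv
  set F : Set (Sym2 W) := (fun v => s(v, par v)) '' {ρ}ᶜ with hF
  have hinj : Set.InjOn (fun v => s(v, par v)) ({ρ}ᶜ : Set W) := by
    intro v hv w hw hvw
    rcases Sym2.eq_iff.1 hvw with ⟨h, -⟩ | ⟨h1, h2⟩
    · exact h
    -- Otherwise `v` and `w` would be each other's parents, each strictly closer to the root.
    · have h3 := (hpar v hv).2
      have h4 := (hpar w hw).2
      rw [h2] at h3
      rw [← h1] at h4
      omega
  have hFE : F ⊆ G.edgeSet := by
    rintro _ ⟨v, hv, rfl⟩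
    exact (hpar v hv).1
  have hFcard : F.ncard + 1 = Nat.card W := by
    rw [hF, hinj.ncard_image, ← Set.ncard_singleton ρ, add_comm,
      Set.ncard_add_ncard_compl]
  have hrest : (G.edgeSet \ F).ncard ≤ 1 := by
    have := Set.ncard_sdiff_add_ncard_of_subset hFE
    omega
  have he : ∃ e, ∀ e' ∈ G.edgeSet \ F, e' = e := by
    rcases Set.eq_empty_or_nonempty (G.edgeSet \ F) with h | ⟨e, he⟩
    · exact ⟨s(ρ, ρ), by simp [h]⟩
    · exact ⟨e, fun e' he' => (Set.ncard_le_one_iff (Set.toFinite _)).1 hrest he' he⟩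
  obtain ⟨e, he⟩ := he
  refine ⟨ρ, par, fun v => G.dist v ρ, e, by simp [par], dist_self, hpar, fun v w hvw => ?_⟩
  by_cases hmem : s(v, w) ∈ F
  · obtain ⟨u, -, hu⟩ := hmem
    rcases Sym2.eq_iff.1 hu with ⟨rfl, rfl⟩ | ⟨rfl, rfl⟩
    · exact Or.inr (Or.inl rfl)
    · exact Or.inr (Or.inr rfl)
  · exact Or.inl (he _ ⟨hvw, hmem⟩)

/-- Places the vertices `a` steps below `v` in the ball of radius `a` about `v`, so ball growth
bounds the fibres of `par^[a]`. -/
theorem edist_iterate_le {V : Type*} (G : SimpleGraph V) {f : V → V}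
    (hf : ∀ v, f v = v ∨ G.Adj v (f v)) (a : ℕ) (v : V) : G.edist (f^[a] v) v ≤ a := by
  induction a with
  | zero => simp
  | succ a ih =>
    rw [Function.iterate_succ_apply', Nat.cast_succ, add_comm]
    refine G.edist_triangle.trans (add_le_add ?_ ih)
    rw [edist_le_one_iff_adj_or_eq]
    exact (hf _).symm.imp_left G.adj_symm

end SimpleGraph

/-- On a component of a near-forest there is a parent function, defined on the whole vertex set
and trivial outside the component, accounting for all but at most one of the edges. -/
theorem IsNearForest.exists_parent {V : Type*} [Finite V] {H : SimpleGraph V}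
    (hH : IsNearForest H) (c : H.ConnectedComponent) :
    ∃ (ρ : V) (par : V → V) (depth : V → ℕ) (e : Sym2 V), par ρ = ρ ∧ depth ρ = 0 ∧
      (∀ v, par v = v ∨ H.Adj v (par v)) ∧
      (∀ v ∈ c.supp, v ≠ ρ → depth (par v) < depth v) ∧
      ∀ v ∈ c.supp, ∀ w, H.Adj v w → s(v, w) = e ∨ w = par v ∨ v = par w := by
  classical
  have hE : c.toSimpleGraph.edgeSet.ncard ≤ Nat.card c := by
    have := hH c
    rw [treeExcess] at this
    omega
  obtain ⟨ρ, par, depth, e, hρ, hd, hpar, hedge⟩ :=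
    c.connected_toSimpleGraph.exists_parent hE
  -- Fixing the vertices outside the component lets `edist_iterate_le` apply on all of `V`.
  refine ⟨ρ, fun v => if hv : v ∈ c.supp then par ⟨v, hv⟩ else v,
    fun v => if hv : v ∈ c.supp then depth ⟨v, hv⟩ else 0, e.map Subtype.val, ?_, ?_, ?_, ?_, ?_⟩
  · have hρc : (ρ : V) ∈ c.supp := ρ.2
    simp only [hρc, dite_true]
    exact congrArg Subtype.val hρ
  · have hρc : (ρ : V) ∈ c.supp := ρ.2
    simp only [hρc, dite_true]
    exact hd
  · intro v
    by_cases hv : v ∈ c.supp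
    · simp only [hv, dite_true]
      by_cases hvρ : (⟨v, hv⟩ : c) = ρ
      · left
        rw [hvρ, hρ, ← hvρ]
      · exact Or.inr (hpar _ hvρ).1
    · simp [hv]
  · intro v hv hvρ
    have hmem : ((par ⟨v, hv⟩ : c) : V) ∈ c.supp := (par ⟨v, hv⟩).2
    simp only [hv, dite_true, hmem]
    exact (hpar ⟨v, hv⟩ fun h => hvρ (congrArg Subtype.val h)).2
  · intro v hv w hvw
    have hw : w ∈ c.supp := c.mem_supp_of_adj_mem_supp hv hvw
    simp only [hv, hw, dite_true]
    rcases hedge ⟨v, hv⟩ ⟨w, hw⟩ hvw with h | h | h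
    · left
      rw [← h, Sym2.map_mk]
    · exact Or.inr (Or.inl (congrArg Subtype.val h))
    · exact Or.inr (Or.inr (congrArg Subtype.val h))

/-! ### Correlation decay along a rooted tree -/

section Decay

variable {V : Type*} [Fintype V] [DecidableEq V]

/-- Exponential decay of correlations for interactions along a rooted tree: the correlation of two
vertices is controlled by the length of a path between them through a common ancestor. -/
theorem exists_abs_isingCov_le_pow {J : Matrix V V ℝ} (hJ : J.IsSymm) (h : V → ℝ) {β : ℝ}
    (hβ : ∀ i j, |J i j| ≤ β) {C : Set V} {ρ : V} {par : V → V} {depth : V → ℕ}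
    (hρ : par ρ = ρ) (hd : depth ρ = 0) (hpar : ∀ v ∈ C, par v ∈ C)
    (hdec : ∀ v ∈ C, v ≠ ρ → depth (par v) < depth v)
    (hC : ∀ v ∈ C, ∀ w, J v w ≠ 0 → w ∈ C)
    (hedge : ∀ v ∈ C, ∀ w, J v w ≠ 0 → w = par v ∨ v = par w) :
    ∀ i ∈ C, ∀ j ∈ C, ∃ a ≤ depth i, ∃ b ≤ depth j,
      par^[a] i = par^[b] j ∧ |isingCov J h i j| ≤ β ^ a * β ^ b := by
  have hiter : ∀ k, ∀ v ∈ C, depth (par^[k] v) ≤ depth v := by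
    intro k
    induction k with
    | zero => intro v _; exact le_rfl
    | succ k ih =>
      intro v hv
      rw [Function.iterate_succ_apply]
      by_cases hvρ : v = ρ
      · subst hvρ; rw [hρ]; exact ih _ hv
      · exact (ih _ (hpar v hv)).trans (hdec v hv hvρ).le
  have hstep : ∀ i ∈ C, ∀ j ∈ C, i ≠ j → depth j ≤ depth i →
      depth (par i) < depth i ∧ |isingCov J h i j| ≤ β * |isingCov J h (par i) j| := by
    intro i hi j hj hij hle
    have hiρ : i ≠ ρ := by
      rintro rfl
      have := hdec j hj hij.symm
      omega
    have hlt := hdec i hi hiρ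
    refine ⟨hlt, ?_⟩
    -- The cut is the subtree below `i`. It excludes `j`, which differs from `i` and is no deeper,
    -- and only the edge from `i` to its parent leaves it.
    refine (abs_isingCov_step hJ h (fun v => v ∈ C ∧ ∃ k, par^[k] v = i) (i := i)
      (i' := par i) (j := j) ⟨hi, 0, rfl⟩ ?_ ?_ ?_).trans
      (mul_le_mul_of_nonneg_right (hβ _ _) (abs_nonneg _))
    · rintro ⟨-, k, hk⟩
      have := hiter k _ (hpar i hi)
      rw [hk] at this
      omega
    · rintro ⟨-, k, hk⟩
      cases k with
      | zero => exact hij hk.symm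
      | succ k =>
        by_cases hjρ : j = ρ
        · subst hjρ
          exact hij ((Function.iterate_fixed hρ (k + 1)).symm.trans hk).symm
        · have h1 := hdec j hj hjρ
          have h2 := hiter k _ (hpar j hj)
          rw [← Function.iterate_succ_apply, hk] at h2
          omega
    · rintro k l ⟨hk, m, hm⟩ hl h0
      rcases hedge k hk l h0 with rfl | rfl
      · cases m with
        | zero =>
          obtain rfl : k = i := hm
          exact ⟨rfl, rfl⟩
        | succ m => exact absurd ⟨hpar k hk, m, hm⟩ hl
      · exact absurd ⟨hC _ hk l h0, m + 1, hm⟩ hl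
  -- Induction on the total depth, always replacing the deeper vertex by its parent.
  suffices H : ∀ n, ∀ i ∈ C, ∀ j ∈ C, depth i + depth j ≤ n → ∃ a ≤ depth i, ∃ b ≤ depth j,
      par^[a] i = par^[b] j ∧ |isingCov J h i j| ≤ β ^ a * β ^ b from
    fun i hi j hj => H _ i hi j hj le_rfl
  intro n
  induction n with
  | zero =>
    intro i hi j hj hn
    by_cases hij : i = j
    · subst hij
      exact ⟨0, by omega, 0, by omega, rfl, by simpa using abs_isingCov_self_le J h i⟩
    · have := (hstep i hi j hj hij (by omega)).1
      omega
  | succ n ih =>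
    intro i hi j hj hn
    by_cases hij : i = j
    · subst hij
      exact ⟨0, by omega, 0, by omega, rfl, by simpa using abs_isingCov_self_le J h i⟩
    have hβ0 : 0 ≤ β := (abs_nonneg _).trans (hβ i i)
    rcases le_total (depth j) (depth i) with hle | hle
    · obtain ⟨hlt, hcov⟩ := hstep i hi j hj hij hle
      obtain ⟨a, ha, b, hb, hab, hle'⟩ := ih (par i) (hpar i hi) j hj (by omega)
      refine ⟨a + 1, by omega, b, hb, hab, hcov.trans ?_⟩
      calc β * |isingCov J h (par i) j| ≤ β * (β ^ a * β ^ b) := by gcongr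
        _ = _ := by ring
    · obtain ⟨hlt, hcov⟩ := hstep j hj i hi (Ne.symm hij) hle
      obtain ⟨a, ha, b, hb, hab, hle'⟩ := ih i hi (par j) (hpar j hj) (by omega)
      refine ⟨a, ha, b + 1, by omega, hab, ?_⟩
      rw [isingCov_comm] at hle' ⊢
      refine hcov.trans ?_
      calc β * |isingCov J h (par j) i| ≤ β * (β ^ a * β ^ b) := by gcongr
        _ = _ := by ring

end Decay

/-! ### Quadratic forms with ancestor decay -/

theorem sum_sq_sum_fiber_le {V : Type*} [Fintype V] [DecidableEq V] (f : V → V) (T : Finset V)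
    {B : ℝ} (hB : ∀ u, ((T.filter fun v => f v = u).card : ℝ) ≤ B) (y : V → ℝ) :
    ∑ u, (∑ i ∈ T with f i = u, y i) ^ 2 ≤ B * ∑ i ∈ T, y i ^ 2 := by
  rw [← Finset.sum_fiberwise T f fun i => y i ^ 2, Finset.mul_sum]
  refine Finset.sum_le_sum fun u _ => sq_sum_le_card_mul_sum_sq.trans ?_
  exact mul_le_mul_of_nonneg_right (hB u) (Finset.sum_nonneg fun i _ => sq_nonneg _)

/-- Cauchy–Schwarz over `a` with weights `γ ^ a`: the factor `D ^ (-a)` left on the squared fibre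
sums cancels the fibre size `D ^ a * K`, and each of the two sums contributes `1 / (1 - γ)`. -/
theorem sum_sq_sum_pow_mul_le {V : Type*} [Fintype V] [DecidableEq V] {par : V → V}
    {T : Finset V} {D γ K : ℝ} (hD : 0 < D) (hγ0 : 0 ≤ γ) (hγ1 : γ < 1) (hK : 0 ≤ K)
    (hcount : ∀ (a : ℕ) (u : V), ((T.filter fun v => par^[a] v = u).card : ℝ) ≤ D ^ a * K)
    (N : ℕ) (y : V → ℝ) :
    ∑ u, (∑ a ∈ Finset.range N, (γ / √D) ^ a * ∑ i ∈ T with par^[a] i = u, y i) ^ 2 ≤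
      K / (1 - γ) ^ 2 * ∑ i ∈ T, y i ^ 2 := by
  have hs : 0 < √D := Real.sqrt_pos.2 hD
  have hgeom : ∑ a ∈ Finset.range N, γ ^ a ≤ (1 - γ)⁻¹ := by
    rw [← tsum_geometric_of_lt_one hγ0 hγ1]
    exact (summable_geometric_of_lt_one hγ0 hγ1).sum_le_tsum _ fun a _ => pow_nonneg hγ0 a
  have hg0 : 0 ≤ ∑ a ∈ Finset.range N, γ ^ a := Finset.sum_nonneg fun a _ => pow_nonneg hγ0 a
  set Q := ∑ i ∈ T, y i ^ 2
  have hQ : 0 ≤ Q := Finset.sum_nonneg fun i _ => sq_nonneg _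
  let Y : ℕ → V → ℝ := fun a u => ∑ i ∈ T with par^[a] i = u, y i
  have hfiber : ∀ a, ∑ u, (Y a u) ^ 2 / D ^ a ≤ K * Q := by
    intro a
    rw [← Finset.sum_div, div_le_iff₀ (pow_pos hD a)]
    exact (sum_sq_sum_fiber_le (par^[a]) T (hcount a) y).trans_eq (by ring)
  calc ∑ u, (∑ a ∈ Finset.range N, (γ / √D) ^ a * Y a u) ^ 2
      ≤ ∑ u, (∑ a ∈ Finset.range N, γ ^ a) *
          ∑ a ∈ Finset.range N, γ ^ a * ((Y a u) ^ 2 / D ^ a) := by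
        refine Finset.sum_le_sum fun u _ => ?_
        refine Finset.sum_sq_le_sum_mul_sum_of_sq_le_mul _ (fun a _ => pow_nonneg hγ0 a)
          (fun a _ => mul_nonneg (pow_nonneg hγ0 a)
            (div_nonneg (sq_nonneg _) (pow_pos hD a).le)) fun a _ => ?_
        have : (√D ^ a) ^ 2 = D ^ a := by rw [← pow_mul, mul_comm, pow_mul, Real.sq_sqrt hD.le]
        rw [mul_pow, div_pow, div_pow, this]
        exact le_of_eq (by ring)
    _ = (∑ a ∈ Finset.range N, γ ^ a) *
          ∑ a ∈ Finset.range N, γ ^ a * ∑ u, (Y a u) ^ 2 / D ^ a := by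
        rw [← Finset.mul_sum, Finset.sum_comm]
        simp only [Finset.mul_sum]
    _ ≤ (∑ a ∈ Finset.range N, γ ^ a) * ∑ a ∈ Finset.range N, γ ^ a * (K * Q) := by
        refine mul_le_mul_of_nonneg_left (Finset.sum_le_sum fun a _ => ?_) hg0
        exact mul_le_mul_of_nonneg_left (hfiber a) (pow_nonneg hγ0 a)
    _ = (∑ a ∈ Finset.range N, γ ^ a) ^ 2 * (K * Q) := by rw [← Finset.sum_mul]; ring
    _ ≤ ((1 - γ)⁻¹) ^ 2 * (K * Q) := by gcongr
    _ = _ := by rw [inv_pow]; ring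

/-- A quadratic form whose entries decay along paths through common ancestors is bounded by the
sizes of the sets of descendants. -/
theorem quadratic_le_of_ancestor_decay {V : Type*} [Fintype V] [DecidableEq V] {par : V → V}
    {T : Finset V} {D γ K : ℝ} (hD : 0 < D) (hγ0 : 0 ≤ γ) (hγ1 : γ < 1) (hK : 0 ≤ K)
    (hcount : ∀ (a : ℕ) (u : V), ((T.filter fun v => par^[a] v = u).card : ℝ) ≤ D ^ a * K)
    {M : Matrix V V ℝ} {depth : V → ℕ}
    (hM : ∀ i ∈ T, ∀ j ∈ T, ∃ a ≤ depth i, ∃ b ≤ depth j,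
      par^[a] i = par^[b] j ∧ |M i j| ≤ (γ / √D) ^ a * (γ / √D) ^ b) (x : V → ℝ) :
    ∑ i ∈ T, ∑ j ∈ T, x i * x j * M i j ≤ K / (1 - γ) ^ 2 * ∑ i ∈ T, x i ^ 2 := by
  set β := γ / √D
  have hβ : 0 ≤ β := div_nonneg hγ0 (Real.sqrt_nonneg D)
  -- The bounds `a ≤ depth i` make this finite range of steps enough for every `i ∈ T`.
  let N := T.sup depth + 1
  let n : V → V → ℝ := fun i u => ∑ a ∈ Finset.range N, if par^[a] i = u then β ^ a else 0
  have hterm : ∀ i u a, (0 : ℝ) ≤ if par^[a] i = u then β ^ a else 0 := fun i u a => by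
    split_ifs <;> positivity
  have hn0 : ∀ i u, 0 ≤ n i u := fun i u => Finset.sum_nonneg fun a _ => hterm i u a
  have hn : ∀ i ∈ T, ∀ a ≤ depth i, β ^ a ≤ n i (par^[a] i) := by
    intro i hi a ha
    have haN : a ∈ Finset.range N :=
      Finset.mem_range.2 (Nat.lt_succ_of_le (ha.trans (Finset.le_sup hi)))
    refine le_trans ?_ (Finset.single_le_sum (fun a _ => hterm i _ a) haN)
    simp
  -- Gram domination: the common ancestor supplied by `hM` is a single term of the sum over `u`.
  have hMn : ∀ i ∈ T, ∀ j ∈ T, |M i j| ≤ ∑ u, n i u * n j u := by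
    intro i hi j hj
    obtain ⟨a, ha, b, hb, hab, hle⟩ := hM i hi j hj
    refine hle.trans (le_trans ?_ (Finset.single_le_sum
      (fun u _ => mul_nonneg (hn0 i u) (hn0 j u)) (Finset.mem_univ (par^[a] i))))
    refine mul_le_mul (hn i hi a ha) ?_ (pow_nonneg hβ b) (hn0 _ _)
    rw [hab]
    exact hn j hj b hb
  calc ∑ i ∈ T, ∑ j ∈ T, x i * x j * M i j
      ≤ ∑ i ∈ T, ∑ j ∈ T, |x i| * |x j| * ∑ u, n i u * n j u := by
        refine Finset.sum_le_sum fun i hi => Finset.sum_le_sum fun j hj => ?_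
        refine (le_abs_self _).trans ?_
        rw [abs_mul, abs_mul]
        exact mul_le_mul_of_nonneg_left (hMn i hi j hj) (by positivity)
    _ = ∑ u, (∑ i ∈ T, |x i| * n i u) ^ 2 := by
        simp only [sq, Finset.sum_mul_sum]
        rw [Finset.sum_comm (s := Finset.univ)]
        refine Finset.sum_congr rfl fun i _ => ?_
        rw [Finset.sum_comm (s := Finset.univ)]
        refine Finset.sum_congr rfl fun j _ => ?_
        rw [Finset.mul_sum]
        exact Finset.sum_congr rfl fun u _ => by ring
    _ = ∑ u, (∑ a ∈ Finset.range N, β ^ a * ∑ i ∈ T with par^[a] i = u, |x i|) ^ 2 := by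
        refine Finset.sum_congr rfl fun u _ => ?_
        congr 1
        simp only [n, Finset.mul_sum]
        rw [Finset.sum_comm]
        refine Finset.sum_congr rfl fun a _ => ?_
        rw [Finset.sum_filter]
        refine Finset.sum_congr rfl fun i _ => ?_
        split_ifs <;> ring
    _ ≤ K / (1 - γ) ^ 2 * ∑ i ∈ T, |x i| ^ 2 :=
        sum_sq_sum_pow_mul_le hD hγ0 hγ1 hK hcount N fun i => |x i|
    _ = _ := by simp only [sq_abs]

/-! ### Assembling the bound over components -/

section NearForest

variable {V : Type*} [Fintype V] [DecidableEq V]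

/-- An erased edge removes two symmetric entries; the resulting `2 * β` is halved by the `1 / 2` in
the Ising exponent. -/
theorem sum_sum_abs_sub_erase_le {J : Matrix V V ℝ} {β : ℝ} (hJ : ∀ i j, |J i j| ≤ β)
    (e : Sym2 V) :
    ∑ i, ∑ j, |J i j - if s(i, j) = e then 0 else J i j| ≤ 2 * β := by
  induction e using Sym2.ind with
  | _ a b =>
  calc ∑ i, ∑ j, |J i j - if s(i, j) = s(a, b) then 0 else J i j|
      ≤ ∑ i, ∑ j, ((if i = a then (if j = b then β else 0) else 0) +
          (if i = b then (if j = a then β else 0) else 0)) := by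
        refine Finset.sum_le_sum fun i _ => Finset.sum_le_sum fun j _ => ?_
        have h1 := hJ i j
        have h2 := (abs_nonneg _).trans h1
        by_cases h : s(i, j) = s(a, b)
        · rw [if_pos h, sub_zero]
          rcases Sym2.eq_iff.1 h with ⟨rfl, rfl⟩ | ⟨rfl, rfl⟩
          · rw [if_pos rfl, if_pos rfl]
            refine h1.trans (le_add_of_nonneg_right ?_)
            split_ifs <;> simp [h2]
          · rw [if_pos rfl (c := i = i), if_pos rfl (c := j = j)]
            refine h1.trans (le_add_of_nonneg_left ?_)
            split_ifs <;> simp [h2]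
        · rw [if_neg h, sub_self, abs_zero]
          refine add_nonneg ?_ ?_ <;> split_ifs <;> simp [h2]
    _ = 2 * β := by
        simp only [Finset.sum_add_distrib]
        simp [two_mul]

theorem sum_ite_mul_ite_mul (T : Finset V) (x : V → ℝ) (M : Matrix V V ℝ) :
    ∑ i, ∑ j, (if i ∈ T then x i else 0) * (if j ∈ T then x j else 0) * M i j =
      ∑ i ∈ T, ∑ j ∈ T, x i * x j * M i j := by
  rw [← Finset.sum_subset (Finset.subset_univ T) fun i _ hi => by simp [hi]]
  refine Finset.sum_congr rfl fun i hi => ?_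
  rw [← Finset.sum_subset (Finset.subset_univ T) fun j _ hj => by simp [hj]]
  exact Finset.sum_congr rfl fun j hj => by rw [if_pos hi, if_pos hj]

/-- Bound on the quadratic form of the covariance matrix within a single component. -/
theorem IsNearForest.sum_isingCov_component_le {H : SimpleGraph V} (hH : IsNearForest H)
    {T : Finset V} {D γ K : ℝ} (hD : 0 < D) (hγ0 : 0 ≤ γ) (hγ1 : γ < 1) (hK : 0 ≤ K)
    (hball : ∀ (a : ℕ) (u : V),
      ({v : V | v ∈ T ∧ H.edist u v ≤ (a : ℕ∞)}.ncard : ℝ) ≤ D ^ a * K)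
    {J : Matrix V V ℝ} (hJ : J.IsSymm) (hsupp : ∀ i j, ¬ H.Adj i j → J i j = 0)
    (hbound : ∀ i j, |J i j| ≤ γ / √D) (h : V → ℝ) (c : H.ConnectedComponent)
    (hTc : ∀ v ∈ T, v ∈ c.supp) (x : V → ℝ) :
    ∑ i ∈ T, ∑ j ∈ T, x i * x j * isingCov J h i j ≤
      Real.exp (2 * (γ / √D)) * (K / (1 - γ) ^ 2 * ∑ i ∈ T, x i ^ 2) := by
  obtain ⟨ρ, par, depth, e, hρ, hd, hpar, hdec, hedge⟩ := hH.exists_parent c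
  let J' : Matrix V V ℝ := Matrix.of fun i j => if s(i, j) = e then 0 else J i j
  have hJ' : J'.IsSymm := Matrix.IsSymm.ext fun i j => by
    simp only [J', Matrix.of_apply, Sym2.eq_swap (a := j), hJ.apply]
  have hne : ∀ i j, J' i j ≠ 0 → s(i, j) ≠ e ∧ H.Adj i j := by
    intro i j h0
    simp only [J', Matrix.of_apply, ne_eq, ite_eq_left_iff, not_forall] at h0
    obtain ⟨h1, h2⟩ := h0
    exact ⟨h1, by_contra fun hadj => h2 (hsupp i j hadj)⟩
  have hβ' : ∀ i j, |J' i j| ≤ γ / √D := by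
    intro i j
    simp only [J', Matrix.of_apply]
    split_ifs
    · rw [abs_zero]
      exact (abs_nonneg _).trans (hbound i j)
    · exact hbound i j
  have hcount : ∀ (a : ℕ) (u : V),
      ((T.filter fun v => par^[a] v = u).card : ℝ) ≤ D ^ a * K := by
    intro a u
    refine le_trans ?_ (hball a u)
    rw [← Set.ncard_coe_finset, Nat.cast_le]
    refine Set.ncard_le_ncard ?_ (Set.toFinite _)
    intro v hv
    rw [Finset.mem_coe, Finset.mem_filter] at hv
    exact ⟨hv.1, hv.2 ▸ H.edist_iterate_le hpar a v⟩
  have hdecay := exists_abs_isingCov_le_pow hJ' h hβ' (C := c.supp) hρ hd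
    (fun v hv => by
      rcases hpar v with h1 | h1
      · rwa [h1]
      · exact c.mem_supp_of_adj_mem_supp hv h1)
    hdec (fun v hv w h0 => c.mem_supp_of_adj_mem_supp hv (hne v w h0).2)
    (fun v hv w h0 => (hedge v hv w (hne v w h0).2).resolve_left (hne v w h0).1)
  -- The variance comparison concerns full sums, so `x` is extended by zero off `T`.
  have h1 := sum_mul_isingCov_le_exp_mul h (J' := J') (sum_sum_abs_sub_erase_le hbound e)
    fun i => if i ∈ T then x i else 0
  rw [sum_ite_mul_ite_mul, sum_ite_mul_ite_mul] at h1
  refine h1.trans (mul_le_mul_of_nonneg_left ?_ (Real.exp_pos _).le)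
  exact quadratic_le_of_ancestor_decay hD hγ0 hγ1 hK hcount
    (fun i hi j hj => hdecay i (hTc i hi) j (hTc j hj)) x

theorem isingCov_eq_zero_of_connectedComponentMk_ne {H : SimpleGraph V} {J : Matrix V V ℝ}
    (hJ : J.IsSymm) (hsupp : ∀ i j, ¬ H.Adj i j → J i j = 0) (h : V → ℝ) {i j : V}
    (hij : H.connectedComponentMk j ≠ H.connectedComponentMk i) : isingCov J h i j = 0 := by
  refine isingCov_eq_zero_of_separated hJ h
    (fun v => H.connectedComponentMk v = H.connectedComponentMk i) rfl hij ?_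
  intro k l hk hl
  refine hsupp k l fun hadj => hl ?_
  rw [← hk]
  exact (SimpleGraph.ConnectedComponent.connectedComponentMk_eq_of_adj hadj).symm

/-- The covariance is block diagonal over components, so the component bounds add up with no loss.
-/
theorem IsNearForest.sum_isingCov_le {H : SimpleGraph V} (hH : IsNearForest H)
    {T : Finset V} {D γ K : ℝ} (hD : 0 < D) (hγ0 : 0 ≤ γ) (hγ1 : γ < 1) (hK : 0 ≤ K)
    (hball : ∀ (a : ℕ) (u : V),
      ({v : V | v ∈ T ∧ H.edist u v ≤ (a : ℕ∞)}.ncard : ℝ) ≤ D ^ a * K)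
    {J : Matrix V V ℝ} (hJ : J.IsSymm) (hsupp : ∀ i j, ¬ H.Adj i j → J i j = 0)
    (hbound : ∀ i j, |J i j| ≤ γ / √D) (h : V → ℝ) (x : V → ℝ) :
    ∑ i ∈ T, ∑ j ∈ T, x i * x j * isingCov J h i j ≤
      Real.exp (2 * (γ / √D)) * (K / (1 - γ) ^ 2 * ∑ i ∈ T, x i ^ 2) := by
  classical
  have : Fintype H.ConnectedComponent := Fintype.ofFinite _
  obtain ⟨k, hk⟩ : ∃ k : V → H.ConnectedComponent, k = H.connectedComponentMk := ⟨_, rfl⟩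
  rw [← Finset.sum_fiberwise T k,
    ← Finset.sum_fiberwise T k fun i => x i ^ 2, Finset.mul_sum, Finset.mul_sum]
  refine Finset.sum_le_sum fun c _ => ?_
  have hrestrict : ∑ i ∈ T with k i = c,
        ∑ j ∈ T, x i * x j * isingCov J h i j =
      ∑ i ∈ T with k i = c, ∑ j ∈ T with k j = c,
        x i * x j * isingCov J h i j := by
    refine Finset.sum_congr rfl fun i hi => (Finset.sum_filter_of_ne fun j _ h0 => ?_).symm
    rw [← (Finset.mem_filter.1 hi).2]
    by_contra hij
    subst hk
    exact h0 (by rw [isingCov_eq_zero_of_connectedComponentMk_ne hJ hsupp h hij, mul_zero])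
  rw [hrestrict]
  refine hH.sum_isingCov_component_le hD hγ0 hγ1 hK (fun a u => ?_) hJ hsupp hbound h c
    (fun v hv => by subst hk; exact (Finset.mem_filter.1 hv).2) x
  refine le_trans (Nat.cast_le.2 (Set.ncard_le_ncard ?_ (Set.toFinite _))) (hball a u)
  exact fun v hv => ⟨(Finset.mem_filter.1 hv.1).1, hv.2⟩

/-- If the balls of radius `a` contain at most `D ^ a * K` points of `T`, then the covariance matrix
restricted to `T` has operator norm at most `exp (2 γ / √D) / (1 - γ) ^ 2 * K`. -/
theorem IsNearForest.opNorm_restrictTo_isingCov_le {H : SimpleGraph V} (hH : IsNearForest H)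
    {T : Finset V} {D γ K : ℝ} (hD : 0 < D) (hγ0 : 0 ≤ γ) (hγ1 : γ < 1) (hK : 0 ≤ K)
    (hball : ∀ (a : ℕ) (u : V),
      ({v : V | v ∈ T ∧ H.edist u v ≤ (a : ℕ∞)}.ncard : ℝ) ≤ D ^ a * K)
    {J : Matrix V V ℝ} (hJ : J.IsSymm) (hsupp : ∀ i j, ¬ H.Adj i j → J i j = 0)
    (hbound : ∀ i j, |J i j| ≤ γ / √D) (h : V → ℝ) :
    opNorm (restrictTo (isingCov J h) T) ≤ Real.exp (2 * γ / √D) / (1 - γ) ^ 2 * K := by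
  refine opNorm_le_of_abs_quadratic_le ?_ (fun x => ?_) (by positivity)
  · refine Matrix.IsSymm.ext fun i j => ?_
    simp only [restrictTo, Matrix.of_apply, and_comm (a := j ∈ T), isingCov_comm J h j i]
  · have e : ∑ i, ∑ j, x i * x j * restrictTo (isingCov J h) T i j =
        ∑ i, ∑ j, (if i ∈ T then x i else 0) * (if j ∈ T then x j else 0) * isingCov J h i j := by
      refine Finset.sum_congr rfl fun i _ => Finset.sum_congr rfl fun j _ => ?_
      by_cases hi : i ∈ T <;> by_cases hj : j ∈ T <;> simp [restrictTo, hi, hj]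
    rw [e, abs_of_nonneg (sum_mul_isingCov_nonneg J h fun i => if i ∈ T then x i else 0),
      sum_ite_mul_ite_mul]
    refine (hH.sum_isingCov_le hD hγ0 hγ1 hK hball hJ hsupp hbound h x).trans ?_
    rw [mul_div_assoc]
    calc Real.exp (2 * (γ / √D)) * (K / (1 - γ) ^ 2 * ∑ i ∈ T, x i ^ 2)
        = Real.exp (2 * (γ / √D)) / (1 - γ) ^ 2 * K * ∑ i ∈ T, x i ^ 2 := by ring
      _ ≤ _ := by
        refine mul_le_mul_of_nonneg_left ?_ (by positivity)
        exact Finset.sum_le_sum_of_subset_of_nonneg (Finset.subset_univ T)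
          fun i _ _ => sq_nonneg _

end NearForest

theorem lemma3p3 {V : Type*} [Fintype V] [DecidableEq V]
    (H : SimpleGraph V) (S : Finset V) (Δ D γ : ℝ)
    (hD : 0 < D) (hγ0 : 0 ≤ γ) (hγ1 : γ < 1)
    (hforest : IsNearForest H) (hpseudo : IsPseudorandom H Δ D S)
    (J : Matrix V V ℝ) (hJsymm : J.IsSymm)
    (hJsupp : ∀ i j, ¬ H.Adj i j → J i j = 0)
    (hJbound : ∀ i j, H.Adj i j → J i j ∈ Set.Icc (-(γ / Real.sqrt D)) (γ / Real.sqrt D))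
    (h : V → ℝ) :
    opNorm (restrictTo (isingCov J h) S)
        ≤ Real.exp (2 * γ / Real.sqrt D) / (1 - γ) ^ 2 ∧
    (D ≤ Δ →
      opNorm (isingCov J h)
        ≤ Real.exp (2 * γ / Real.sqrt D) / (1 - γ) ^ 2 * (Δ / D)) := by
  have hbound : ∀ i j, |J i j| ≤ γ / √D := by
    intro i j
    by_cases hij : H.Adj i j
    · exact abs_le.2 (hJbound i j hij)
    · rw [hJsupp i j hij, abs_zero]
      positivity
  refine ⟨?_, fun hΔ => ?_⟩
  · have := hforest.opNorm_restrictTo_isingCov_le (T := S) hD hγ0 hγ1 zero_le_one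
      (fun a u => by rw [mul_one]; exact hpseudo.ball_inter_le a u) hJsymm hJsupp hbound h
    rwa [mul_one] at this
  · have huniv : restrictTo (isingCov J h) Finset.univ = isingCov J h := by
      ext i j
      simp [restrictTo]
    rw [← huniv]
    refine hforest.opNorm_restrictTo_isingCov_le hD hγ0 hγ1
      (div_nonneg (hD.le.trans hΔ) hD.le) (fun a u => ?_) hJsymm hJsupp hbound h
    simp only [Finset.mem_univ, true_and]
    cases a with
    -- `ball_le` starts at radius `1`; at radius `0` the ball is one point, and the bound is `1 ≤ Δ
    -- / D`.
    | zero =>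
      have : {v : V | H.edist u v ≤ ((0 : ℕ) : ℕ∞)} = {u} := by
        ext v
        simp [eq_comm (a := v)]
      rw [this, Set.ncard_singleton, Nat.cast_one, pow_zero, one_mul]
      exact (one_le_div hD).2 hΔ
    | succ a =>
      refine (hpseudo.ball_le (a + 1) (by omega) u).trans_eq ?_
      rw [Nat.add_sub_cancel, pow_succ]
      field_simp
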